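/- Let $X$ be a compact Hausdorff space, let $E$ and $F$ be Banach spaces (both real or both complex), let $C(X,E)$ be the Banach space of continuous functions $X\to E$ with the uniform norm, and let $B(E^*)$ be the closed unit ball of $E^*$ with the weak$^*$ topology. For Banach spaces $G$, $H$, the injective norm on the algebraic tensor product $G\otimes H$ is $$\Big\|\sum_{i} x_i\otimes y_i\Big\|_\epsilon=\sup\Big\{\Big|\sum_i x^*(x_i)\,y^*(y_i)\Big| : x^*\in G^*,\ y^*\in H^*,\ \|x^*\|\le 1,\ \|y^*\|\le 1\Big\}.$$ A bounded linear operator $T:G\to H$ is called integral if the functional $\sum_i e_i\otimes y_i^*\mapsto\sum_i y_i^*(Te_i)$ on $G\otimes H^*$ is bounded for $\|\cdot\|_\epsilon$, i.e. defines an element of the dual of the completed injective tensor product $G\hat\otimes_\epsilon H^*$; its integral norm is $$\|T\|_{\mathrm{int}}=\sup\Big\{\Big|\sum_i y_i^*(Te_i)\Big| : \Big\|\sum_i e_i\otimes y_i^*\Big\|_\epsilon\le 1\Big\}.$$ If $T:C(X,E)\to F$ is an integral operator, then there exists a regular (countably additive) $F^{**}$-valued vector measure $\theta$ of bounded variation on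 the Borel $\sigma$-field of $X\times B(E^*)$ such that, for every $f\in C(X,E)$, the scalar function $(x,e^*)\mapsto e^*(f(x))$ is integrable with respect to $\theta$ and, for every $y^*\in F^*$, $$\langle y^*,Tf\rangle=\Big\langle y^*,\int_{X\times B(E^*)}e^*(f(x))\,d\theta(x,e^*)\Big\rangle,$$ where the integral is an element of $F^{**}$; and moreover $$|\theta|(X\times B(E^*))=\|T\|_{\mathrm{int}},$$ where $|\theta|$ is the variation of $\theta$. Here regular means: for every Borel set $A$ and every $\varepsilon>0$ there are a compact set $K$ and an open set $U$ with $K\subseteq A\subseteq U$ and $\|\theta(C)\|<\varepsilon$ for every Borel set $C\subseteq U\setminus K$. -/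

import Mathlib

open scoped TensorProduct ENNReal
open MeasureTheory

noncomputable section

namespace IntegralOperator

variable {𝕜 : Type*} [RCLike 𝕜]
variable {E : Type*} [NormedAddCommGroup E] [NormedSpace 𝕜 E]
variable {F : Type*} [NormedAddCommGroup F] [NormedSpace 𝕜 F]

/-- The closed unit ball `B(E*)` of the dual of `E`, with the weak-star topology. -/
abbrev DualBall (𝕜 : Type*) [RCLike 𝕜] (E : Type*) [NormedAddCommGroup E] [NormedSpace 𝕜 E] :
    Type _ :=
  ↥(WeakDual.toStrongDual ⁻¹' Metric.closedBall (0 : StrongDual 𝕜 E) 1 : Set (WeakDual 𝕜 E))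

/-- The functional `φ ⊗ ψ` on `E ⊗ F`, sending `∑ xᵢ ⊗ yᵢ` to `∑ φ(xᵢ) ψ(yᵢ)`. -/
def tensorEval (φ : StrongDual 𝕜 E) (ψ : StrongDual 𝕜 F) : E ⊗[𝕜] F →ₗ[𝕜] 𝕜 :=
  TensorProduct.lift (LinearMap.mk₂ 𝕜 (fun x y => φ x * ψ y)
    (by intros; simp [add_mul]) (by intros; simp [mul_assoc])
    (by intros; simp [mul_add]) (by intros; simp [mul_left_comm]))

@[simp] theorem tensorEval_tmul (φ : StrongDual 𝕜 E) (ψ : StrongDual 𝕜 F) (x : E) (y : F) :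
    tensorEval φ ψ (x ⊗ₜ[𝕜] y) = φ x * ψ y := by
  simp [tensorEval]

/-- The injective norm on the algebraic tensor product:
`‖∑ xᵢ ⊗ yᵢ‖ = sup {|∑ φ(xᵢ) ψ(yᵢ)| : ‖φ‖ ≤ 1, ‖ψ‖ ≤ 1}`. -/
def injectiveNorm (z : E ⊗[𝕜] F) : ℝ :=
  ⨆ p : Metric.closedBall (0 : StrongDual 𝕜 E) 1 × Metric.closedBall (0 : StrongDual 𝕜 F) 1,
    ‖tensorEval p.1.1 p.2.1 z‖

/-- The supremum defining the injective norm is finite. -/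
theorem injectiveNorm_bddAbove (z : E ⊗[𝕜] F) :
    BddAbove (Set.range fun p : Metric.closedBall (0 : StrongDual 𝕜 E) 1 ×
      Metric.closedBall (0 : StrongDual 𝕜 F) 1 => ‖tensorEval p.1.1 p.2.1 z‖) := by
  induction z using TensorProduct.induction_on with
  | zero => exact ⟨0, by rintro _ ⟨p, rfl⟩; simp⟩
  | tmul x y =>
    refine ⟨‖x‖ * ‖y‖, ?_⟩
    rintro _ ⟨⟨⟨φ, hφ⟩, ⟨ψ, hψ⟩⟩, rfl⟩
    have h1 : ‖φ‖ ≤ 1 := by simpa using hφ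
    have h2 : ‖ψ‖ ≤ 1 := by simpa using hψ
    simp only [tensorEval_tmul, norm_mul]
    have h3 : ‖φ x‖ ≤ ‖x‖ := by simpa using φ.le_of_opNorm_le h1 x
    have h4 : ‖ψ y‖ ≤ ‖y‖ := by simpa using ψ.le_of_opNorm_le h2 y
    gcongr
  | add a b ha hb =>
    obtain ⟨A, hA⟩ := ha
    obtain ⟨B, hB⟩ := hb
    refine ⟨A + B, ?_⟩
    rintro _ ⟨p, rfl⟩
    have h1 := hA ⟨p, rfl⟩
    have h2 := hB ⟨p, rfl⟩
    simp only [map_add]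
    exact (norm_add_le _ _).trans (add_le_add h1 h2)

/-- The linear functional on `E ⊗ F*` given by the bilinear form `τ(e, y*) = y*(T e)`. -/
def traceForm (T : E →L[𝕜] F) : E ⊗[𝕜] StrongDual 𝕜 F →ₗ[𝕜] 𝕜 :=
  TensorProduct.lift (LinearMap.mk₂ 𝕜 (fun (e : E) (y : StrongDual 𝕜 F) => y (T e))
    (by intros; simp) (by intros; simp) (by intros; simp) (by intros; simp))

@[simp] theorem traceForm_tmul (T : E →L[𝕜] F) (e : E) (y : StrongDual 𝕜 F) :
    traceForm T (e ⊗ₜ[𝕜] y) = y (T e) := by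
  simp [traceForm]

/-- `T` is an integral operator (in the sense of Grothendieck): the bilinear form
`(e, y*) ↦ y*(T e)` is a functional on `E ⊗ F*` that is bounded for the injective norm, that is,
it extends to an element of the dual of the completion of `E ⊗ F*` in that norm. -/
def IsIntegral (T : E →L[𝕜] F) : Prop :=
  ∃ c : ℝ, ∀ z : E ⊗[𝕜] StrongDual 𝕜 F, ‖traceForm T z‖ ≤ c * injectiveNorm z

/-- The integral norm of an integral operator: the norm of the functional induced by
`(e, y*) ↦ y*(T e)`, for the injective norm on `E ⊗ F*`. -/
def integralNorm (T : E →L[𝕜] F) : ℝ :=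
  sSup {r : ℝ | ∃ z : E ⊗[𝕜] StrongDual 𝕜 F, injectiveNorm z ≤ 1 ∧ r = ‖traceForm T z‖}

/-- Vector measures with values in a normed space `V`, countably additive for the norm topology. -/
abbrev NormedVectorMeasure (Z : Type*) [MeasurableSpace Z] (V : Type*) [NormedAddCommGroup V] :
    Type _ :=
  VectorMeasure Z V

/-- The `V`-valued integral `∫ g dθ` of a scalar function `g` against a `V`-valued vector
measure `θ`. -/
def scalarIntegral {Z : Type*} [MeasurableSpace Z] {V : Type*} [NormedAddCommGroup V]
    [NormedSpace 𝕜 V] [NormedSpace ℝ V] [IsScalarTower ℝ 𝕜 V]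
    (θ : NormedVectorMeasure Z V) (g : Z → 𝕜) : V :=
  VectorMeasure.integral θ g (ContinuousLinearMap.lsmul ℝ 𝕜)

/-- A vector measure on a Borel space is regular if every Borel set `A` can be enclosed as
`K ⊆ A ⊆ U` with `K` compact and `U` open, so that the measure is uniformly small on the Borel
subsets of `U \ K`. -/
def IsRegular {Z : Type*} [TopologicalSpace Z] [MeasurableSpace Z]
    {V : Type*} [NormedAddCommGroup V] (θ : NormedVectorMeasure Z V) : Prop :=
  ∀ A : Set Z, MeasurableSet A → ∀ ε : ℝ, 0 < ε →
    ∃ K U : Set Z, IsCompact K ∧ IsOpen U ∧ K ⊆ A ∧ A ⊆ U ∧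
      ∀ C : Set Z, MeasurableSet C → C ⊆ U \ K → ‖θ C‖ < ε

end IntegralOperator

end

/-! Put K = X × B(E*), which is compact. Since the points of B(E*) norm E, the map f ⊗ y* ↦ e*(f x)
y* carries the injective norm on C(X,E) ⊗ F* to the uniform norm of C(K, F*). The trace form Φ of T
is therefore bounded by N = ‖T‖_int for the uniform norm, and θ is obtained by representing Φ.

Hahn–Banach for the sublinear functional φ ↦ inf_z (N‖(φ + ‖Jz‖)⁺‖ - Re Φ z) on C(K, ℝ), followed by
Riesz, yields a regular measure `lam` of mass at most N with |Φ z| ≤ ∫ ‖Jz‖ d`lam`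
(`exists_dominating_regular_measure`). A second Hahn–Banach extends Φ to a contraction Ψ on
L¹(`lam`, F*), and θ(A)(y*) = Ψ(1_A y*) satisfies |θ| ≤ `lam` (`exists_vectorMeasure_of_L1_dual`).
This domination gives regularity and |θ|(K) ≤ N. Conversely Ψ is integration against θ, so |Φ z| ≤
‖Jz‖ |θ|(K) and N ≤ |θ|(K). -/

namespace IntegralOperator

/-! ### Vector measures dominated by a finite positive measure. -/

section Measure

variable {Z : Type*} [MeasurableSpace Z] {lam : Measure Z} [IsFiniteMeasure lam]

/-- The integral against a vector measure dominated by `lam` is the unique continuous linear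
extension to `L¹(lam)` of its values on indicator functions. -/
theorem integral_eq_of_indicatorConstLp {V G H : Type*} [NormedAddCommGroup V] [NormedSpace ℝ V]
    [NormedAddCommGroup G] [NormedSpace ℝ G] [NormedAddCommGroup H] [NormedSpace ℝ H]
    [CompleteSpace H] (θ : VectorMeasure Z V) (hθ : θ.variation ≤ lam) (B : G →L[ℝ] V →L[ℝ] H)
    (R : Lp G 1 lam →L[ℝ] H)
    (hR : ∀ (A : Set Z) (hA : MeasurableSet A) (x : G),
      R (indicatorConstLp 1 hA (measure_ne_top lam A) x) = B x (θ A))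
    {h : Z → G} (hh : Integrable h lam) :
    θ.integral h B = R (hh.toL1 h) := by
  have hdom : DominatedFinMeasAdditive lam (θ.transpose B) ‖B‖ :=
    (dominatedFinMeasAdditive_cbmApplyMeasure θ B).of_measure_le hθ (norm_nonneg B)
  -- The integral is built on L¹ of the variation; domination by `lam` lets the same extension be
  -- computed on L¹(`lam`), where indicators determine it.
  rw [VectorMeasure.integral_eq_setToFun,
    ← setToFun_congr_measure_of_integrable 1 ENNReal.one_ne_top (by simpa using hθ) hdom
      (dominatedFinMeasAdditive_cbmApplyMeasure θ B) h hh, setToFun_eq hdom hh]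
  refine Lp.induction ENNReal.one_ne_top (motive := fun f => L1.setToL1 hdom f = R f)
    ?_ ?_ ?_ _
  · intro c s hs hμs
    rw [Lp.simpleFunc.coe_indicatorConst, L1.setToL1_indicatorConstLp, hR s hs c]
    rfl
  · intro f g hf hg _ h1 h2
    rw [map_add, map_add, h1, h2]
  · exact isClosed_eq (L1.setToL1 hdom).continuous R.continuous

variable {𝕜 : Type*} [RCLike 𝕜] {V : Type*} [NormedAddCommGroup V] [NormedSpace 𝕜 V]

theorem enorm_apply_indicatorConstLp_le (R : Lp 𝕜 1 lam →L[𝕜] V) (hR : ‖R‖ ≤ 1) {A : Set Z}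
    (hA : MeasurableSet A) :
    ‖R (indicatorConstLp 1 hA (measure_ne_top lam A) (1 : 𝕜))‖ₑ ≤ lam A := by
  refine (R.le_opENorm _).trans ?_
  have h1 : ‖R‖ₑ ≤ 1 := by
    rw [← ofReal_norm]; exact ENNReal.ofReal_le_one.2 hR
  calc _ ≤ 1 * ‖indicatorConstLp 1 hA (measure_ne_top lam A) (1 : 𝕜)‖ₑ := by gcongr
    _ ≤ lam A := by
      rw [one_mul]
      refine enorm_indicatorConstLp_le.trans ?_
      simp

open scoped Classical in
/-- The vector measure `A ↦ R (1_A)` of a contraction `R` on `L¹(lam)`. -/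
noncomputable def vectorMeasureOfL1 (R : Lp 𝕜 1 lam →L[𝕜] V) (hR : ‖R‖ ≤ 1) :
    VectorMeasure Z V :=
  VectorMeasure.of_additive_of_le_measure (μ := lam)
    (fun A => if hA : MeasurableSet A then
      R (indicatorConstLp 1 hA (measure_ne_top lam A) (1 : 𝕜)) else 0)
    (by
      intro A
      by_cases hA : MeasurableSet A
      · simpa only [hA, dif_pos] using enorm_apply_indicatorConstLp_le R hR hA
      · simp [hA])
    (by
      intro s t hs ht hst
      simp only [hs, ht, hs.union ht, dif_pos]
      rw [indicatorConstLp_disjoint_union hs ht (measure_ne_top lam s) (measure_ne_top lam t) hst,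
        map_add])
    (by intro s hs; simp [hs])

theorem vectorMeasureOfL1_apply (R : Lp 𝕜 1 lam →L[𝕜] V) (hR : ‖R‖ ≤ 1) {A : Set Z}
    (hA : MeasurableSet A) :
    vectorMeasureOfL1 R hR A = R (indicatorConstLp 1 hA (measure_ne_top lam A) (1 : 𝕜)) :=
  dif_pos hA

theorem variation_vectorMeasureOfL1_le (R : Lp 𝕜 1 lam →L[𝕜] V) (hR : ‖R‖ ≤ 1) :
    (vectorMeasureOfL1 R hR).variation ≤ lam := by
  refine VectorMeasure.variation_le_of_forall_enorm_le fun A hA => ?_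
  rw [vectorMeasureOfL1_apply R hR hA]
  exact enorm_apply_indicatorConstLp_le R hR hA

theorem indicatorConstLp_eq_smul_one {A : Set Z} (hA : MeasurableSet A) (a : 𝕜) :
    indicatorConstLp 1 hA (measure_ne_top lam A) a
      = a • indicatorConstLp 1 hA (measure_ne_top lam A) (1 : 𝕜) := by
  ext1
  filter_upwards [indicatorConstLp_coeFn (p := 1) (hs := hA) (hμs := measure_ne_top lam A) (c := a),
    indicatorConstLp_coeFn (p := 1) (hs := hA) (hμs := measure_ne_top lam A) (c := (1 : 𝕜)),
    Lp.coeFn_smul a (indicatorConstLp 1 hA (measure_ne_top lam A) (1 : 𝕜))] with x h1 h2 h3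
  rw [h1, h3, Pi.smul_apply, h2]
  by_cases hx : x ∈ A <;> simp [hx]

theorem scalarIntegral_vectorMeasureOfL1 [CompleteSpace V] [NormedSpace ℝ V] [IsScalarTower ℝ 𝕜 V]
    (R : Lp 𝕜 1 lam →L[𝕜] V) (hR : ‖R‖ ≤ 1) {g : Z → 𝕜} (hg : Integrable g lam) :
    scalarIntegral (vectorMeasureOfL1 R hR) g = R (hg.toL1 g) := by
  refine integral_eq_of_indicatorConstLp _ (variation_vectorMeasureOfL1_le R hR) _
    (R.restrictScalars ℝ) (fun A hA x => ?_) hg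
  rw [vectorMeasureOfL1_apply R hR hA, ContinuousLinearMap.coe_restrictScalars',
    indicatorConstLp_eq_smul_one, map_smul]
  rfl

/-- A vector measure whose variation is dominated by a finite regular measure is regular. -/
theorem isRegular_of_variation_le [TopologicalSpace Z] [T2Space Z] [BorelSpace Z] [lam.Regular]
    {V : Type*} [NormedAddCommGroup V]
    (θ : VectorMeasure Z V) (hθ : θ.variation ≤ lam) : IsRegular θ := by
  intro A hA ε hε
  have hε2 : ENNReal.ofReal (ε / 2) ≠ 0 := by simp [hε]
  -- U \ K lies in (U \ A) ∪ (A \ K), and each piece receives half of ε.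
  obtain ⟨U, hAU, hU, hUlt⟩ := hA.exists_isOpen_sdiff_lt (measure_ne_top lam A) hε2
  obtain ⟨K, hKA, hK, hKlt⟩ := hA.exists_isCompact_sdiff_lt (measure_ne_top lam A) hε2
  refine ⟨K, U, hK, hU, hKA, hAU, fun C hC hCUK => ?_⟩
  have hlt : ‖θ C‖ₑ < ENNReal.ofReal ε := by
    calc ‖θ C‖ₑ ≤ θ.variation C := θ.enorm_measure_le_variation C
      _ ≤ lam C := hθ C
      _ ≤ lam ((U \ A) ∪ (A \ K)) := measure_mono fun x hx => by
          have := hCUK hx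
          by_cases hxA : x ∈ A
          · exact Or.inr ⟨hxA, this.2⟩
          · exact Or.inl ⟨this.1, hxA⟩
      _ ≤ lam (U \ A) + lam (A \ K) := measure_union_le _ _
      _ < ENNReal.ofReal (ε / 2) + ENNReal.ofReal (ε / 2) := ENNReal.add_lt_add hUlt.2 hKlt
      _ = ENNReal.ofReal ε := by
          rw [← ENNReal.ofReal_add (by positivity) (by positivity), add_halves]
  rw [← ofReal_norm] at hlt
  exact (ENNReal.ofReal_lt_ofReal_iff hε).1 hlt

end Measure

/-! ### Domination of a functional by a positive regular measure. -/

section Domination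

variable {K : Type*} [TopologicalSpace K] [CompactSpace K]
variable {𝕜 : Type*} [RCLike 𝕜] {M : Type*} [AddCommGroup M] [Module 𝕜 M]
variable {W : Type*} [NormedAddCommGroup W] [NormedSpace 𝕜 W]

/-- The values `N t - Re Φ z` over `t ≥ 0` and `z` with `φ + ‖J z‖ ≤ t` pointwise. -/
def dominationSet (J : M →ₗ[𝕜] C(K, W)) (Φ : M →ₗ[𝕜] 𝕜) (N : ℝ) (φ : C(K, ℝ)) : Set ℝ :=
  {r | ∃ (z : M) (t : ℝ), 0 ≤ t ∧ (∀ k, φ k + ‖J z k‖ ≤ t) ∧ r = N * t - RCLike.re (Φ z)}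

variable {J : M →ₗ[𝕜] C(K, W)} {Φ : M →ₗ[𝕜] 𝕜} {N : ℝ}

theorem dominationSet_nonempty (φ : C(K, ℝ)) : (dominationSet J Φ N φ).Nonempty :=
  ⟨_, 0, ‖φ‖, norm_nonneg _, fun k => by
    simpa using (le_abs_self (φ k)).trans (φ.norm_coe_le_norm k), rfl⟩

/-- From φ + ‖Jz‖ ≤ t follows ‖Jz‖ ≤ t + ‖φ‖, so Re Φ z exceeds N t by at most N‖φ‖. The condition t
≥ 0 keeps this valid when K is empty. -/
theorem dominationSet_bddBelow (hN : 0 ≤ N) (hΦ : ∀ z, ‖Φ z‖ ≤ N * ‖J z‖) (φ : C(K, ℝ)) :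
    BddBelow (dominationSet J Φ N φ) := by
  refine ⟨-(N * ‖φ‖), ?_⟩
  rintro _ ⟨z, t, ht, hz, rfl⟩
  have h1 : ‖J z‖ ≤ t + ‖φ‖ := by
    refine (ContinuousMap.norm_le _ (by positivity)).2 fun k => ?_
    have := (neg_abs_le (φ k))
    have h2 : |φ k| ≤ ‖φ‖ := φ.norm_coe_le_norm k
    linarith [hz k]
  have h2 : RCLike.re (Φ z) ≤ N * (t + ‖φ‖) :=
    (RCLike.re_le_norm _).trans ((hΦ z).trans (by gcongr))
  linarith

theorem sInf_dominationSet_add_le (hN : 0 ≤ N) (hΦ : ∀ z, ‖Φ z‖ ≤ N * ‖J z‖) (φ ψ : C(K, ℝ)) :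
    sInf (dominationSet J Φ N (φ + ψ))
      ≤ sInf (dominationSet J Φ N φ) + sInf (dominationSet J Φ N ψ) := by
  refine le_of_forall_pos_lt_add fun ε hε => ?_
  obtain ⟨_, ⟨z, t, ht, hz, rfl⟩, h1⟩ :=
    Real.lt_sInf_add_pos (dominationSet_nonempty (J := J) (Φ := Φ) (N := N) φ) (half_pos hε)
  obtain ⟨_, ⟨z', t', ht', hz', rfl⟩, h2⟩ :=
    Real.lt_sInf_add_pos (dominationSet_nonempty (J := J) (Φ := Φ) (N := N) ψ) (half_pos hε)
  have h3 : sInf (dominationSet J Φ N (φ + ψ)) ≤ N * (t + t') - RCLike.re (Φ (z + z')) := by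
    refine csInf_le (dominationSet_bddBelow hN hΦ _)
      ⟨z + z', t + t', by positivity, fun k => ?_, rfl⟩
    have := norm_add_le (J z k) (J z' k)
    simp only [map_add, ContinuousMap.add_apply]
    linarith [hz k, hz' k]
  simp only [map_add] at h3
  linarith

theorem sInf_dominationSet_smul_le (hN : 0 ≤ N) (hΦ : ∀ z, ‖Φ z‖ ≤ N * ‖J z‖) {c : ℝ}
    (hc : 0 < c) (φ : C(K, ℝ)) :
    sInf (dominationSet J Φ N (c • φ)) ≤ c * sInf (dominationSet J Φ N φ) := by
  rw [← div_le_iff₀' hc]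
  refine le_csInf (dominationSet_nonempty _) ?_
  rintro _ ⟨z, t, ht, hz, rfl⟩
  rw [div_le_iff₀' hc]
  refine csInf_le (dominationSet_bddBelow hN hΦ _)
    ⟨(c : 𝕜) • z, c * t, by positivity, fun k => ?_, ?_⟩
  · have : ‖J ((c : 𝕜) • z) k‖ = c * ‖J z k‖ := by
      simp [norm_smul, abs_of_pos hc]
    rw [this, ContinuousMap.smul_apply, smul_eq_mul, ← mul_add]
    exact mul_le_mul_of_nonneg_left (hz k) hc.le
  · rw [map_smul, smul_eq_mul, RCLike.re_ofReal_mul]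
    ring

theorem sInf_dominationSet_smul (hN : 0 ≤ N) (hΦ : ∀ z, ‖Φ z‖ ≤ N * ‖J z‖) {c : ℝ}
    (hc : 0 < c) (φ : C(K, ℝ)) :
    sInf (dominationSet J Φ N (c • φ)) = c * sInf (dominationSet J Φ N φ) := by
  refine (sInf_dominationSet_smul_le hN hΦ hc φ).antisymm ?_
  -- The reverse inequality is the same one for the scalar c⁻¹.
  have h := sInf_dominationSet_smul_le hN hΦ (inv_pos.2 hc) (c • φ)
  rw [smul_smul, inv_mul_cancel₀ hc.ne', one_smul] at h
  rwa [← le_inv_mul_iff₀ hc]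

/-- A functional bounded by `N` times the uniform norm is dominated by a positive functional of
mass at most `N` applied to the pointwise norm. -/
theorem exists_dominating_positive_functional (hN : 0 ≤ N) (hΦ : ∀ z, ‖Φ z‖ ≤ N * ‖J z‖) :
    ∃ l : C(K, ℝ) →ₗ[ℝ] ℝ, (∀ φ : C(K, ℝ), (∀ k, 0 ≤ φ k) → 0 ≤ l φ) ∧ l 1 ≤ N ∧
      ∀ z (φ : C(K, ℝ)), (∀ k, φ k = ‖J z k‖) → ‖Φ z‖ ≤ l φ := by
  obtain ⟨l, -, hl⟩ := exists_extension_of_le_sublinear (⊥ : C(K, ℝ) →ₗ.[ℝ] ℝ)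
    (fun φ => sInf (dominationSet J Φ N φ))
    (fun c hc φ => sInf_dominationSet_smul hN hΦ hc φ)
    (fun φ ψ => sInf_dominationSet_add_le hN hΦ φ ψ)
    (by
      rintro ⟨x, hx⟩
      obtain rfl : x = 0 := (Submodule.mem_bot ℝ).1 hx
      -- Homogeneity forces the sublinear functional to vanish at 0, so it dominates the zero
      -- functional on the trivial subspace.
      have h0 : sInf (dominationSet J Φ N ((2 : ℝ) • (0 : C(K, ℝ)))) = 2 * _ :=
        sInf_dominationSet_smul hN hΦ two_pos 0
      rw [smul_zero] at h0
      have h1 : (⊥ : C(K, ℝ) →ₗ.[ℝ] ℝ) ⟨0, hx⟩ = 0 := map_zero _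
      rw [h1]
      simp only
      linarith)
  have key : ∀ (φ : C(K, ℝ)) (z : M) (t : ℝ), 0 ≤ t → (∀ k, φ k + ‖J z k‖ ≤ t) →
      l φ ≤ N * t - RCLike.re (Φ z) := fun φ z t ht h =>
    (hl φ).trans (csInf_le (dominationSet_bddBelow hN hΦ φ) ⟨z, t, ht, h, rfl⟩)
  refine ⟨l, fun φ hφ => ?_, ?_, fun z φ hφ => ?_⟩
  · have := key (-φ) 0 0 le_rfl (fun k => by simpa using hφ k)
    simp only [map_neg, map_zero, mul_zero, sub_zero] at this
    linarith
  · simpa using key 1 0 1 zero_le_one (fun k => by simp)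
  -- A unimodular c makes Φ(c z) equal to |Φ z|; with φ = ‖Jz‖, the function -φ + ‖J(c z)‖ is zero,
  -- so t = 0 is admissible.
  · obtain ⟨c, hc, hcz⟩ := RCLike.exists_norm_eq_mul_self (Φ z)
    have := key (-φ) (c • z) 0 le_rfl (fun k => by simp [norm_smul, hc, hφ k])
    rw [map_smul, smul_eq_mul, ← hcz, RCLike.ofReal_re, map_neg] at this
    linarith

variable [MeasurableSpace K] [BorelSpace K]

theorem integrable_continuousMap {G : Type*} [NormedAddCommGroup G] (f : C(K, G)) (lam : Measure K)
    [IsFiniteMeasure lam] : Integrable f lam :=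
  f.continuous.integrable_of_hasCompactSupport (HasCompactSupport.of_compactSpace _)

/-- A functional bounded by `N` times the uniform norm is dominated by the `L¹` norm of a regular
measure of mass at most `N`. -/
theorem exists_dominating_regular_measure [T2Space K] (hN : 0 ≤ N) (hΦ : ∀ z, ‖Φ z‖ ≤ N * ‖J z‖) :
    ∃ lam : Measure K, lam.Regular ∧ IsFiniteMeasure lam ∧ lam Set.univ ≤ ENNReal.ofReal N ∧
      ∀ z, ‖Φ z‖ ≤ ∫ k, ‖J z k‖ ∂lam := by
  obtain ⟨l, hpos, hone, hdom⟩ := exists_dominating_positive_functional hN hΦ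
  let Λ : CompactlySupportedContinuousMap K ℝ →ₚ[ℝ] ℝ :=
  { toFun g := l g.toContinuousMap
    map_add' g g' := map_add l g.toContinuousMap g'.toContinuousMap
    map_smul' c g := map_smul l c g.toContinuousMap
    monotone' g g' hgg' := by
      have := hpos (g'.toContinuousMap - g.toContinuousMap) (fun k => sub_nonneg.2 (hgg' k))
      rw [map_sub] at this
      exact sub_nonneg.1 this }
  have hint : ∀ φ : C(K, ℝ), ∫ k, φ k ∂(RealRMK.rieszMeasure Λ) = l φ := fun φ =>
    RealRMK.integral_rieszMeasure Λ ⟨φ, HasCompactSupport.of_compactSpace _⟩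
  refine ⟨RealRMK.rieszMeasure Λ, inferInstance, inferInstance, ?_, fun z => ?_⟩
  · have h1 := hint 1
    simp only [ContinuousMap.one_apply, integral_const, smul_eq_mul, mul_one] at h1
    rw [← ofReal_measureReal, h1]
    exact ENNReal.ofReal_le_ofReal hone
  · have := hint ⟨fun k => ‖J z k‖, (J z).continuous.norm⟩
    simp only [ContinuousMap.coe_mk] at this
    rw [this]
    exact hdom z _ fun k => rfl

/-- A functional dominated by the `L¹(lam)` norm extends to a contraction on `L¹(lam, W)`. -/
theorem exists_L1_extension (lam : Measure K) [IsFiniteMeasure lam]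
    (hdom : ∀ z, ‖Φ z‖ ≤ ∫ k, ‖J z k‖ ∂lam) :
    ∃ Ψ : StrongDual 𝕜 (Lp W 1 lam), ‖Ψ‖ ≤ 1 ∧
      ∀ z, Ψ ((integrable_continuousMap (J z) lam).toL1 (J z)) = Φ z := by
  let I : M →ₗ[𝕜] Lp W 1 lam :=
  { toFun z := (integrable_continuousMap (J z) lam).toL1 (J z)
    map_add' z z' := by
      rw [← Integrable.toL1_add]
      simp only [map_add, ContinuousMap.coe_add]
    map_smul' c z := by
      rw [RingHom.id_apply, ← Integrable.toL1_smul']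
      simp only [map_smul, ContinuousMap.coe_smul] }
  have hI : ∀ z, ‖Φ z‖ ≤ ‖I z‖ := fun z => by
    refine (hdom z).trans_eq ?_
    rw [L1.norm_eq_integral_norm]
    refine integral_congr_ae ?_
    filter_upwards [(integrable_continuousMap (J z) lam).coeFn_toL1] with k hk
    exact congrArg norm hk.symm
  -- `I` need not be injective. Φ is moved to its range along a linear section; the choice is
  -- harmless because |Φ z| ≤ ‖I z‖ makes Φ vanish on the kernel.
  obtain ⟨s, hs⟩ := I.rangeRestrict.exists_rightInverse_of_surjective I.range_rangeRestrict
  have hs' : ∀ w : LinearMap.range I, I (s w) = w := fun w =>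
    congrArg Subtype.val (LinearMap.congr_fun hs w)
  let f : StrongDual 𝕜 (LinearMap.range I) := (Φ ∘ₗ s).mkContinuous 1 fun w => by
    rw [one_mul]
    refine (hI (s w)).trans_eq ?_
    rw [hs' w]
    rfl
  obtain ⟨Ψ, hΨ, hnorm⟩ := exists_extension_norm_eq (LinearMap.range I) f
  refine ⟨Ψ, hnorm ▸ LinearMap.mkContinuous_norm_le _ zero_le_one _, fun z => ?_⟩
  have h1 : Ψ (I z) = Φ (s ⟨I z, z, rfl⟩) := hΨ ⟨I z, z, rfl⟩
  have h2 : ‖Φ (s ⟨I z, z, rfl⟩ - z)‖ ≤ 0 := by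
    refine (hI _).trans_eq ?_
    rw [map_sub, hs', sub_self, norm_zero]
  rw [map_sub] at h2
  exact h1.trans (sub_eq_zero.1 (norm_le_zero_iff.1 h2))

end Domination

/-! ### Functionals on L¹(`lam`, W) as W*-valued measures. -/

section Representation

variable {𝕜 : Type*} [RCLike 𝕜] {W : Type*} [NormedAddCommGroup W] [NormedSpace 𝕜 W]
variable {Z : Type*} [MeasurableSpace Z] {lam : Measure Z}

/-- The operator `g ↦ (w ↦ Ψ (g • w))` from `L¹` to the dual of `W`. -/
noncomputable def dualValuedOperator (Ψ : StrongDual 𝕜 (Lp W 1 lam)) :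
    Lp 𝕜 1 lam →L[𝕜] StrongDual 𝕜 W :=
  ((ContinuousLinearMap.compL 𝕜 (Lp 𝕜 1 lam) (Lp W 1 lam) 𝕜 Ψ).comp
    ((ContinuousLinearMap.lsmul 𝕜 𝕜).flip.compLpL₂ 1 lam)).flip

theorem dualValuedOperator_apply (Ψ : StrongDual 𝕜 (Lp W 1 lam)) (g : Lp 𝕜 1 lam) (w : W) :
    dualValuedOperator Ψ g w = Ψ (((ContinuousLinearMap.lsmul 𝕜 𝕜).flip w).compLp g) := rfl

theorem dualValuedOperator_toL1 (Ψ : StrongDual 𝕜 (Lp W 1 lam)) {g : Z → 𝕜} (hg : Integrable g lam)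
    (w : W) :
    dualValuedOperator Ψ (hg.toL1 g) w
      = Ψ ((hg.smul_const w).toL1 fun k => g k • w) := by
  rw [dualValuedOperator_apply]
  congr 1

theorem norm_dualValuedOperator_le (Ψ : StrongDual 𝕜 (Lp W 1 lam)) (hΨ : ‖Ψ‖ ≤ 1) :
    ‖dualValuedOperator Ψ‖ ≤ 1 := by
  refine ContinuousLinearMap.opNorm_le_bound₂ _ zero_le_one fun g w => ?_
  rw [dualValuedOperator_apply, one_mul]
  refine (Ψ.le_of_opNorm_le hΨ _).trans ?_
  rw [one_mul]
  refine (ContinuousLinearMap.norm_compLp_le _ _).trans ?_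
  rw [mul_comm]
  gcongr
  refine ContinuousLinearMap.opNorm_le_bound _ (norm_nonneg _) fun a => ?_
  simp [norm_smul, mul_comm]

/-- A functional on `L¹` given on indicator functions by the pairing with a vector measure is
controlled by the variation of this measure. -/
theorem norm_le_mul_variation [IsFiniteMeasure lam] {V : Type*} [NormedAddCommGroup V] [NormedSpace 𝕜 V]
    (e : W →L[𝕜] V →L[𝕜] 𝕜) (he : ‖e‖ ≤ 1) (θ : VectorMeasure Z V) (hθ : θ.variation ≤ lam)
    (Ψ : StrongDual 𝕜 (Lp W 1 lam))
    (hΨ : ∀ (A : Set Z) (hA : MeasurableSet A) (x : W),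
      Ψ (indicatorConstLp 1 hA (measure_ne_top lam A) x) = e x (θ A))
    {h : Z → W} (hh : Integrable h lam) {C : ℝ} (hC : ∀ k, ‖h k‖ ≤ C) :
    ‖Ψ (hh.toL1 h)‖ ≤ C * θ.variation.real Set.univ := by
  let : NormedSpace ℝ W := NormedSpace.restrictScalars ℝ 𝕜 W
  let : NormedSpace ℝ V := NormedSpace.restrictScalars ℝ 𝕜 V
  have : IsScalarTower ℝ 𝕜 W := ⟨fun r a x => by rw [Algebra.smul_def, mul_smul]; rfl⟩
  have : IsScalarTower ℝ 𝕜 V := ⟨fun r a x => by rw [Algebra.smul_def, mul_smul]; rfl⟩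
  have : IsFiniteMeasure θ.variation := isFiniteMeasure_of_le lam hθ
  have hB : ‖e.bilinearRestrictScalars ℝ‖ ≤ 1 :=
    ContinuousLinearMap.opNorm_le_bound₂ _ zero_le_one fun w v => by
      refine (e.le_opNorm₂ w v).trans ?_
      gcongr
  -- Ψ is integration against θ, since the two agree on indicators; only the real structure matters
  -- here.
  have key := integral_eq_of_indicatorConstLp θ hθ (e.bilinearRestrictScalars ℝ)
    (Ψ.restrictScalars ℝ) hΨ hh
  rw [ContinuousLinearMap.coe_restrictScalars'] at key
  rw [← key]
  -- On an empty space C may be negative, but both sides are then zero.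
  rcases isEmpty_or_nonempty Z with hZ | ⟨⟨k⟩⟩
  · rw [VectorMeasure.integral_of_isEmpty]
    simp [Measure.real, Set.univ_eq_empty_iff.2 hZ]
  have hC0 : 0 ≤ C := (norm_nonneg _).trans (hC k)
  refine (VectorMeasure.norm_integral_le_of_norm_le_const (Filter.Eventually.of_forall hC)).trans ?_
  gcongr
  exact mul_le_of_le_one_right hC0 hB

theorem apply_indicatorConstLp_eq [IsFiniteMeasure lam] (Ψ : StrongDual 𝕜 (Lp W 1 lam))
    (hΨ : ‖dualValuedOperator Ψ‖ ≤ 1) {A : Set Z} (hA : MeasurableSet A) (x : W) :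
    Ψ (indicatorConstLp 1 hA (measure_ne_top lam A) x)
      = vectorMeasureOfL1 (dualValuedOperator Ψ) hΨ A x := by
  rw [vectorMeasureOfL1_apply _ hΨ hA, dualValuedOperator_apply]
  congr 1
  ext1
  filter_upwards [ContinuousLinearMap.coeFn_compLp ((ContinuousLinearMap.lsmul 𝕜 𝕜).flip x)
    (indicatorConstLp 1 hA (measure_ne_top lam A) (1 : 𝕜)),
    indicatorConstLp_coeFn (p := 1) (hs := hA) (hμs := measure_ne_top lam A) (c := x),
    indicatorConstLp_coeFn (p := 1) (hs := hA) (hμs := measure_ne_top lam A) (c := (1 : 𝕜))]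
    with k h1 h2 h3
  rw [h1, h2, h3]
  by_cases hx : k ∈ A <;> simp [hx]

/-- Every contraction on `L¹(lam, W)` is represented by a `W*`-valued vector measure. -/
theorem exists_vectorMeasure_of_L1_dual [IsFiniteMeasure lam] (Ψ : StrongDual 𝕜 (Lp W 1 lam))
    (hΨ : ‖Ψ‖ ≤ 1) :
    ∃ θ : NormedVectorMeasure Z (StrongDual 𝕜 W), θ.variation ≤ lam ∧
      (∀ (g : Z → 𝕜) (hg : Integrable g lam) (w : W),
        scalarIntegral θ g w = Ψ ((hg.smul_const w).toL1 fun k => g k • w)) ∧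
      ∀ {h : Z → W} (hh : Integrable h lam) {C : ℝ}, (∀ k, ‖h k‖ ≤ C) →
        ‖Ψ (hh.toL1 h)‖ ≤ C * θ.variation.real Set.univ := by
  have hR := norm_dualValuedOperator_le Ψ hΨ
  have hvar := variation_vectorMeasureOfL1_le _ hR
  refine ⟨vectorMeasureOfL1 (dualValuedOperator Ψ) hR, hvar, fun g hg w => ?_, fun hh C hC => ?_⟩
  · rw [scalarIntegral_vectorMeasureOfL1 _ hR hg, dualValuedOperator_toL1]
  · refine norm_le_mul_variation (ContinuousLinearMap.apply 𝕜 𝕜) ?_ _ hvar Ψ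
      (fun A hA x => apply_indicatorConstLp_eq Ψ hR hA x) hh hC
    exact ContinuousLinearMap.opNorm_le_bound₂ _ zero_le_one fun w v => by
      rw [ContinuousLinearMap.apply_apply, one_mul, mul_comm]
      exact v.le_opNorm w

end Representation

/-! ### The injective norm and the integral norm. -/

section Tensor

variable {𝕜 : Type*} [RCLike 𝕜]
variable {E : Type*} [NormedAddCommGroup E] [NormedSpace 𝕜 E]
variable {F : Type*} [NormedAddCommGroup F] [NormedSpace 𝕜 F]

theorem le_injectiveNorm {z : E ⊗[𝕜] F} {φ : StrongDual 𝕜 E} {ψ : StrongDual 𝕜 F}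
    (hφ : ‖φ‖ ≤ 1) (hψ : ‖ψ‖ ≤ 1) : ‖tensorEval φ ψ z‖ ≤ injectiveNorm z :=
  le_ciSup (injectiveNorm_bddAbove z)
    (⟨⟨φ, by simpa using hφ⟩, ⟨ψ, by simpa using hψ⟩⟩ :
      Metric.closedBall (0 : StrongDual 𝕜 E) 1 × Metric.closedBall (0 : StrongDual 𝕜 F) 1)

theorem injectiveNorm_nonneg (z : E ⊗[𝕜] F) : 0 ≤ injectiveNorm z :=
  Real.iSup_nonneg fun _ => norm_nonneg _

theorem injectiveNorm_smul (c : 𝕜) (z : E ⊗[𝕜] F) :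
    injectiveNorm (c • z) = ‖c‖ * injectiveNorm z := by
  simp only [injectiveNorm, map_smul, norm_smul]
  exact (Real.mul_iSup_of_nonneg (norm_nonneg c) _).symm

theorem injectiveNorm_le {z : E ⊗[𝕜] F} {C : ℝ} (hC : 0 ≤ C)
    (h : ∀ (φ : StrongDual 𝕜 E) (ψ : StrongDual 𝕜 F), ‖φ‖ ≤ 1 → ‖ψ‖ ≤ 1 →
      ‖tensorEval φ ψ z‖ ≤ C) : injectiveNorm z ≤ C :=
  Real.iSup_le (fun p => h _ _ (mem_closedBall_zero_iff.1 p.1.2) (mem_closedBall_zero_iff.1 p.2.2)) hC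

variable {T : E →L[𝕜] F}

theorem integralNorm_bddAbove (hT : IsIntegral T) :
    BddAbove {r : ℝ | ∃ z : E ⊗[𝕜] StrongDual 𝕜 F, injectiveNorm z ≤ 1 ∧ r = ‖traceForm T z‖} := by
  obtain ⟨c, hc⟩ := hT
  refine ⟨|c|, ?_⟩
  rintro _ ⟨z, hz, rfl⟩
  calc ‖traceForm T z‖ ≤ c * injectiveNorm z := hc z
    _ ≤ |c| * 1 := mul_le_mul (le_abs_self c) hz (injectiveNorm_nonneg z) (abs_nonneg c)
    _ = |c| := mul_one _

theorem integralNorm_nonneg (T : E →L[𝕜] F) : 0 ≤ integralNorm T :=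
  Real.sSup_nonneg fun _ ⟨_, _, h⟩ => h ▸ norm_nonneg _

theorem norm_traceForm_le (hT : IsIntegral T) (z : E ⊗[𝕜] StrongDual 𝕜 F) :
    ‖traceForm T z‖ ≤ integralNorm T * injectiveNorm z := by
  -- A tensor of norm zero cannot be normalized; there the bound defining integrality already makes
  -- the trace form vanish.
  rcases (injectiveNorm_nonneg z).eq_or_lt with h0 | hpos
  · obtain ⟨c, hc⟩ := hT
    simpa [← h0] using hc z
  · let c : 𝕜 := ((injectiveNorm z)⁻¹ : ℝ)
    have hc : ‖c‖ = (injectiveNorm z)⁻¹ := by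
      rw [RCLike.norm_ofReal, abs_of_pos (inv_pos.2 hpos)]
    have hmem : ‖traceForm T (c • z)‖ ≤ integralNorm T := by
      refine le_csSup (integralNorm_bddAbove hT) ⟨_, ?_, rfl⟩
      rw [injectiveNorm_smul, hc, inv_mul_cancel₀ hpos.ne']
    rwa [map_smul, norm_smul, hc, inv_mul_le_iff₀ hpos, mul_comm] at hmem

end Tensor

/-! ### The embedding of C(X,E) ⊗ W into C(X × B(E*), W). -/

section Evaluation

variable {𝕜 : Type*} [RCLike 𝕜]
variable {X : Type*} [TopologicalSpace X]
variable {E : Type*} [NormedAddCommGroup E] [NormedSpace 𝕜 E]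
variable {W : Type*} [NormedAddCommGroup W] [NormedSpace 𝕜 W]

theorem norm_dualBall_apply_le (e : DualBall 𝕜 E) (v : E) : ‖e.1 v‖ ≤ ‖v‖ := by
  have h : ‖WeakDual.toStrongDual e.1‖ ≤ 1 := mem_closedBall_zero_iff.1 e.2
  simpa using (WeakDual.toStrongDual e.1).le_of_opNorm_le h v

/-- The continuous function `(x, e*) ↦ e*(f x)` on `X × B(E*)`. -/
noncomputable def ballEval (f : C(X, E)) : C(X × DualBall 𝕜 E, 𝕜) where
  toFun p := p.2.1 (f p.1)
  continuous_toFun := by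
    rw [continuous_iff_continuousAt]
    rintro ⟨x, e⟩
    -- Joint continuity comes from the bound ‖e*‖ ≤ 1: varying the point costs at most ‖f p.1 - f
    -- x‖, uniformly in e*, and weak-star continuity handles the vector f x.
    have h1 : Filter.Tendsto (fun p : X × DualBall 𝕜 E => p.2.1 (f p.1 - f x)) (nhds (x, e))
        (nhds 0) := by
      refine squeeze_zero_norm (fun p => norm_dualBall_apply_le p.2 _) ?_
      have : Continuous fun p : X × DualBall 𝕜 E => ‖f p.1 - f x‖ := by fun_prop
      simpa using this.tendsto (x, e)
    have h2 : Filter.Tendsto (fun p : X × DualBall 𝕜 E => p.2.1 (f x)) (nhds (x, e))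
        (nhds (e.1 (f x))) :=
      (((WeakDual.eval_continuous (f x)).comp continuous_subtype_val).comp
        continuous_snd).tendsto (x, e)
    have := h1.add h2
    simpa [ContinuousAt] using this

@[simp] theorem ballEval_apply (f : C(X, E)) (p : X × DualBall 𝕜 E) :
    ballEval f p = p.2.1 (f p.1) := rfl

variable [CompactSpace X]

/-- The map `C(X, E) ⊗ W → C(X × B(E*), W)` sending `f ⊗ w` to `(x, e*) ↦ e*(f x) w`. -/
noncomputable def tensorToContinuous (𝕜 X E W : Type*) [RCLike 𝕜] [TopologicalSpace X] [CompactSpace X]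
    [NormedAddCommGroup E] [NormedSpace 𝕜 E] [NormedAddCommGroup W] [NormedSpace 𝕜 W] :
    C(X, E) ⊗[𝕜] W →ₗ[𝕜] C(X × DualBall 𝕜 E, W) :=
  TensorProduct.lift (LinearMap.mk₂ 𝕜
    (fun f w => ⟨fun p => ballEval (𝕜 := 𝕜) f p • w, by fun_prop⟩)
    (by intros; ext; simp [add_smul]) (by intros; ext; simp [mul_smul])
    (by intros; ext; simp) (by intros; ext; simp [smul_smul, mul_comm]))

@[simp] theorem tensorToContinuous_tmul (f : C(X, E)) (w : W) (p : X × DualBall 𝕜 E) :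
    tensorToContinuous 𝕜 X E W (f ⊗ₜ[𝕜] w) p = p.2.1 (f p.1) • w := rfl

/-- Applying `ψ` in the second tensor factor. -/
theorem tensorEval_eq_apply_rid (φ : StrongDual 𝕜 C(X, E)) (ψ : StrongDual 𝕜 W)
    (z : C(X, E) ⊗[𝕜] W) :
    tensorEval φ ψ z = φ (TensorProduct.rid 𝕜 _ (LinearMap.lTensor C(X, E) ψ.toLinearMap z)) := by
  induction z using TensorProduct.induction_on with
  | zero => simp
  | tmul f w => simp [mul_comm]
  | add a b ha hb => simp [ha, hb]

theorem apply_tensorToContinuous (ψ : StrongDual 𝕜 W) (z : C(X, E) ⊗[𝕜] W)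
    (p : X × DualBall 𝕜 E) :
    ψ (tensorToContinuous 𝕜 X E W z p)
      = p.2.1 ((TensorProduct.rid 𝕜 _ (LinearMap.lTensor C(X, E) ψ.toLinearMap z)) p.1) := by
  induction z using TensorProduct.induction_on with
  | zero => simp
  | tmul f w => simp [mul_comm]
  | add a b ha hb => simp [ha, hb]

/-- Contracting z with ψ leaves a function g in C(X,E), and ‖g x‖ is attained by some e* in B(E*).
Functionals of the form e* ∘ δ_x thus suffice to bound every φ. -/
theorem injectiveNorm_le_norm_tensorToContinuous (z : C(X, E) ⊗[𝕜] W) {C : ℝ} (hC : 0 ≤ C)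
    (h : ∀ p, ‖tensorToContinuous 𝕜 X E W z p‖ ≤ C) : injectiveNorm z ≤ C := by
  refine injectiveNorm_le hC fun φ ψ hφ hψ => ?_
  rw [tensorEval_eq_apply_rid]
  set g := TensorProduct.rid 𝕜 _ (LinearMap.lTensor C(X, E) ψ.toLinearMap z) with hg
  have h1 : ‖φ g‖ ≤ ‖g‖ := by simpa using φ.le_of_opNorm_le hφ g
  refine h1.trans ((ContinuousMap.norm_le _ hC).2 fun x => ?_)
  obtain ⟨e, he, hex⟩ := exists_dual_vector'' 𝕜 (g x)
  let p : X × DualBall 𝕜 E := (x, ⟨StrongDual.toWeakDual e, by simpa using he⟩)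
  have h2 : ψ (tensorToContinuous 𝕜 X E W z p) = ‖g x‖ :=
    (apply_tensorToContinuous ψ z p).trans hex
  have h3 : ‖ψ (tensorToContinuous 𝕜 X E W z p)‖ ≤ C := by
    refine (ψ.le_of_opNorm_le hψ _).trans ?_
    simpa using h p
  simpa [h2] using h3

/-- For p = (x, e*), the functional e* ∘ δ_x lies in the unit ball of C(X,E)*, so it competes in the
supremum, paired with a ψ norming the value at p. -/
theorem norm_tensorToContinuous_apply_le (z : C(X, E) ⊗[𝕜] W) (p : X × DualBall 𝕜 E) :
    ‖tensorToContinuous 𝕜 X E W z p‖ ≤ injectiveNorm z := by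
  obtain ⟨ψ, hψ, hψz⟩ := exists_dual_vector'' 𝕜 (tensorToContinuous 𝕜 X E W z p)
  let φ : StrongDual 𝕜 C(X, E) := (WeakDual.toStrongDual p.2.1).comp (ContinuousMap.evalCLM 𝕜 p.1)
  have hφ : ‖φ‖ ≤ 1 := ContinuousLinearMap.opNorm_le_bound _ zero_le_one fun f => by
    rw [one_mul]
    exact (norm_dualBall_apply_le p.2 (f p.1)).trans (f.norm_coe_le_norm p.1)
  have h1 := le_injectiveNorm (z := z) hφ hψ
  have h2 : tensorEval φ ψ z = ψ (tensorToContinuous 𝕜 X E W z p) := by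
    rw [tensorEval_eq_apply_rid, apply_tensorToContinuous]
    rfl
  simpa [h2, hψz] using h1

end Evaluation

end IntegralOperator

/-! ### The representing measure and the equality of norms. -/

open IntegralOperator in
theorem lemma2 {𝕜 : Type*} [RCLike 𝕜]
    {X : Type*} [TopologicalSpace X] [CompactSpace X] [T2Space X]
    {E : Type*} [NormedAddCommGroup E] [NormedSpace 𝕜 E] [CompleteSpace E]
    {F : Type*} [NormedAddCommGroup F] [NormedSpace 𝕜 F] [CompleteSpace F]
    [MeasurableSpace (X × IntegralOperator.DualBall 𝕜 E)]
    [BorelSpace (X × IntegralOperator.DualBall 𝕜 E)]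
    (T : C(X, E) →L[𝕜] F) (hT : IntegralOperator.IsIntegral T) :
    ∃ θ : IntegralOperator.NormedVectorMeasure (X × IntegralOperator.DualBall 𝕜 E) (StrongDual 𝕜 (StrongDual 𝕜 F)),
      IntegralOperator.IsRegular θ ∧
      θ.variation Set.univ < ∞ ∧
      (∀ f : C(X, E),
        θ.Integrable (fun p : X × IntegralOperator.DualBall 𝕜 E => p.2.1 (f p.1)) ∧
        ∀ y : StrongDual 𝕜 F,
          y (T f) = IntegralOperator.scalarIntegral θ
            (fun p : X × IntegralOperator.DualBall 𝕜 E => p.2.1 (f p.1)) y) ∧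
      θ.variation Set.univ = ENNReal.ofReal (IntegralOperator.integralNorm T) := by
  have hcompact : CompactSpace (DualBall 𝕜 E) :=
    isCompact_iff_compactSpace.1 (WeakDual.isCompact_closedBall (0 : StrongDual 𝕜 E) 1)
  have hN := integralNorm_nonneg T
  have hΦ : ∀ z, ‖traceForm T z‖
      ≤ integralNorm T * ‖tensorToContinuous 𝕜 X E (StrongDual 𝕜 F) z‖ := fun z =>
    (norm_traceForm_le hT z).trans (mul_le_mul_of_nonneg_left
      (injectiveNorm_le_norm_tensorToContinuous z (norm_nonneg _)
        fun p => ContinuousMap.norm_coe_le_norm _ p) hN)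
  obtain ⟨lam, hreg, hfin, hmass, hdom⟩ := exists_dominating_regular_measure hN hΦ
  obtain ⟨Ψ, hΨ, hΨΦ⟩ := exists_L1_extension lam hdom
  obtain ⟨θ, hvar, hint, hnorm⟩ := exists_vectorMeasure_of_L1_dual Ψ hΨ
  have hfinθ : IsFiniteMeasure θ.variation := isFiniteMeasure_of_le lam hvar
  refine ⟨θ, isRegular_of_variation_le θ hvar, measure_lt_top _ _, fun f => ?_, ?_⟩
  · have hf : Integrable (fun p : X × DualBall 𝕜 E => p.2.1 (f p.1)) lam :=
      integrable_continuousMap (ballEval f) lam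
    refine ⟨hf.mono_measure hvar, fun y => ?_⟩
    rw [hint _ hf y, ← traceForm_tmul T f y, ← hΨΦ]
    rfl
  · refine le_antisymm ((hvar _).trans hmass) ?_
    rw [← ofReal_measureReal]
    -- A tensor of injective norm at most 1 becomes a function bounded by 1, whose integral against
    -- θ is at most the total variation.
    refine ENNReal.ofReal_le_ofReal (Real.sSup_le ?_ measureReal_nonneg)
    rintro _ ⟨z, hz, rfl⟩
    rw [← hΨΦ z]
    exact (hnorm _ fun p => (norm_tensorToContinuous_apply_le z p).trans hz).trans_eq (one_mul _)
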